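/- Let $X$ be a complex Banach space and let $T$ be a bounded linear operator on $X$. Suppose that there is a point $\mu$ in the topological boundary $\partial\sigma(T)$ of the spectrum of $T$ that is not an eigenvalue of $T$. Then $T$ has an almost-invariant half-space $Y$ with defect one. That is, $Y$ is a norm-closed subspace of $X$ with $\dim Y=\infty$ and $\dim X/Y=\infty$, there is a finite-dimensional subspace $M\subseteq X$ such that $TY\subseteq Y+M$, and the minimal dimension of such an $M$ is exactly $1$. Moreover, $Y$ can be chosen of the following form. There are a vector $e\in X$ with $\|e\|=1$, a sequence $(\lambda_n)$ in the resolvent set of $T$ with $\lambda_n\to\mu$ and $\|(\lambda_nI-T)^{-1}e\|\to\infty$, and a subsequence $(x_{n_k})_k$ of the normalized resolvent vectors $$x_n=\frac{(\lambda_n I-T)^{-1}e}{\|(\lambda_n I-T)^{-1}e\|}$$ such that $(x_{n_k})_k$ is a basic sequence and $Y$ is the closed linear span of $\{x_{n_k}: k\in\mathbb N\}$. Here a sequence $(y_k)$ in $X$ is called basic if every vector $y$ in its closed linear span can be written in a unique way as a norm-convergent series $y=\sum_{k} a_k y_k$ with scalars $a_k\in\mathbb C$. -/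

import Mathlib

open Filter Topology

/-- The closed linear span `[x_n]` of a sequence of vectors. -/
def closedSpan {X : Type*} [NormedAddCommGroup X] [NormedSpace ℂ X] (x : ℕ → X) :
    Submodule ℂ X :=
  (Submodule.span ℂ (Set.range x)).topologicalClosure

/-- A half-space: a norm-closed subspace of infinite dimension and infinite codimension. -/
def IsHalfSpace {X : Type*} [NormedAddCommGroup X] [NormedSpace ℂ X] (Y : Submodule ℂ X) :
    Prop :=
  IsClosed (Y : Set X) ∧ ¬ FiniteDimensional ℂ Y ∧ ¬ FiniteDimensional ℂ (X ⧸ Y)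

/-- `Y` is almost-invariant under `T`: it is a closed subspace and `T Y ⊆ Y + M` for some
finite-dimensional subspace `M`. -/
def IsAlmostInvariant {X : Type*} [NormedAddCommGroup X] [NormedSpace ℂ X]
    (T : X →L[ℂ] X) (Y : Submodule ℂ X) : Prop :=
  IsClosed (Y : Set X) ∧
    ∃ M : Submodule ℂ X, FiniteDimensional ℂ M ∧ ∀ y ∈ Y, T y ∈ Y ⊔ M

/-- The defect of `Y` for `T` is (exactly) `d`: the number `d` is the minimal dimension of a
finite-dimensional subspace `M` with `T Y ⊆ Y + M`. -/
def HasDefect {X : Type*} [NormedAddCommGroup X] [NormedSpace ℂ X]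
    (T : X →L[ℂ] X) (Y : Submodule ℂ X) (d : ℕ) : Prop :=
  IsLeast {k : ℕ | ∃ M : Submodule ℂ X, FiniteDimensional ℂ M ∧ Module.finrank ℂ M = k ∧
    ∀ y ∈ Y, T y ∈ Y ⊔ M} d

/-- A basic sequence: every vector of the closed span has exactly one expansion
`∑ a_n x_n`, the partial sums converging in norm. -/
def IsBasicSequence {X : Type*} [NormedAddCommGroup X] [NormedSpace ℂ X] (x : ℕ → X) : Prop :=
  ∀ y ∈ closedSpan x, ∃! a : ℕ → ℂ,
    Tendsto (fun N : ℕ => ∑ n ∈ Finset.range N, a n • x n) atTop (𝓝 y)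

/-- The resolvent vector `h(l, e) = (l I - T)⁻¹ e`, meant for `l` in the resolvent set. -/
noncomputable def resolventVec {X : Type*} [NormedAddCommGroup X] [NormedSpace ℂ X]
    (T : X →L[ℂ] X) (l : ℂ) (e : X) : X :=
  resolvent T l e

/-- The normalized resolvent vector `h(l, e) / ‖h(l, e)‖`. -/
noncomputable def normalizedResolventVec {X : Type*} [NormedAddCommGroup X] [NormedSpace ℂ X]
    (T : X →L[ℂ] X) (l : ℂ) (e : X) : X :=
  ((‖resolventVec T l e‖⁻¹ : ℝ) : ℂ) • resolventVec T l e

/-! The resolvent blows up at a boundary point of the spectrum, so uniform boundedness gives a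
vector `e` whose resolvent orbit is unbounded along some `λ_n → μ`. Since `T x_n = λ_n x_n - c_n e`
with `c_n → 0`, the closed span of any of the `x_n` is carried into itself plus `ℂ e`. A weak limit
`y` of the `x_n` along a free ultrafilter satisfies `T y = μ y`, hence is zero.

So the weak-star limit `Φ` of the `x_n` in the bidual is either zero or outside `X`. Then `X` embeds
isomorphically into the dual of `ker Φ`, where the `x_n` tend pointwise to zero but stay bounded
below in norm. Mazur's selection extracts a subsequence with the Grünblum condition there, and it
pulls back to `X`.

Its even and odd halves each span a half-space, and `e` cannot lie in both. A half `Y` that misses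
`e` has defect exactly one, because invariance of `Y` would force `e ∈ Y`. -/

/-! ### Basic sequences through bounded partial sums and biorthogonal functionals. -/

section BasicSequences

variable {X : Type*} [NormedAddCommGroup X] [NormedSpace ℂ X]

/-- The Grünblum condition: the initial partial sums of a finite linear combination of the `x i`
are bounded by `K` times the norm of the combination. -/
def GrunblumCondition (K : ℝ) (x : ℕ → X) : Prop :=
  ∀ (a : ℕ → ℂ) (m n : ℕ), m ≤ n →
    ‖∑ i ∈ Finset.range m, a i • x i‖ ≤ K * ‖∑ i ∈ Finset.range n, a i • x i‖

theorem linearCombination_eq_sum_range (x : ℕ → X) (l : ℕ →₀ ℂ) {n : ℕ}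
    (hn : ∀ i ∈ l.support, i < n) :
    Finsupp.linearCombination ℂ x l = ∑ i ∈ Finset.range n, l i • x i := by
  rw [Finsupp.linearCombination_apply]
  exact Finsupp.sum_of_support_subset l (fun i hi => Finset.mem_range.2 (hn i hi)) _ (by simp)

/-- A term is the difference of two consecutive partial sums, whence the factor `2 * K`. -/
theorem GrunblumCondition.norm_coeff_le {K : ℝ} {x : ℕ → X} (hG : GrunblumCondition K x)
    (hx : ∀ i, ‖x i‖ = 1) (l : ℕ →₀ ℂ) (j : ℕ) :
    ‖l j‖ ≤ 2 * K * ‖Finsupp.linearCombination ℂ x l‖ := by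
  obtain ⟨n, hn⟩ : ∃ n, ∀ i ∈ insert j l.support, i < n :=
    ⟨(insert j l.support).sup id + 1, fun i hi =>
      Nat.lt_succ_of_le (Finset.le_sup (f := id) hi)⟩
  have hj : j < n := hn j (Finset.mem_insert_self _ _)
  rw [linearCombination_eq_sum_range x l fun i hi => hn i (Finset.mem_insert_of_mem hi)]
  have h1 := hG l (j + 1) n hj
  have h2 := hG l j n hj.le
  rw [Finset.sum_range_succ] at h1
  have h3 : ‖l j‖ = ‖(∑ i ∈ Finset.range j, l i • x i + l j • x j)
      - ∑ i ∈ Finset.range j, l i • x i‖ := by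
    rw [add_sub_cancel_left, norm_smul, hx, mul_one]
  rw [h3]
  linarith [norm_sub_le (∑ i ∈ Finset.range j, l i • x i + l j • x j)
    (∑ i ∈ Finset.range j, l i • x i)]

theorem GrunblumCondition.linearIndependent {K : ℝ} {x : ℕ → X} (hG : GrunblumCondition K x)
    (hx : ∀ i, ‖x i‖ = 1) : LinearIndependent ℂ x := by
  rw [linearIndependent_iff]
  intro l hl
  ext j
  simpa [hl] using hG.norm_coeff_le hx l j

/-- Coordinates are bounded on the algebraic span, so Hahn–Banach extends them to `X`. -/
theorem GrunblumCondition.exists_biorthogonal {K : ℝ} {x : ℕ → X} (hG : GrunblumCondition K x)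
    (hx : ∀ i, ‖x i‖ = 1) :
    ∃ g : ℕ → StrongDual ℂ X, ∀ i j, g i (x j) = if i = j then 1 else 0 := by
  have hli := hG.linearIndependent hx
  have key : ∀ i, ∃ g : StrongDual ℂ X, ∀ j, g (x j) = if i = j then 1 else 0 := by
    intro i
    let f : Submodule.span ℂ (Set.range x) →ₗ[ℂ] ℂ := (Finsupp.lapply i).comp hli.repr
    obtain ⟨g, hg, -⟩ := exists_extension_norm_eq _ (f.mkContinuous (2 * K) fun y => by
      simpa [f, hli.linearCombination_repr] using hG.norm_coeff_le hx (hli.repr y) i)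
    refine ⟨g, fun j => ?_⟩
    rw [show x j = ((⟨x j, Submodule.subset_span ⟨j, rfl⟩⟩ : Submodule.span ℂ (Set.range x)) : X)
      from rfl, hg]
    simp only [LinearMap.mkContinuous_apply, f, LinearMap.comp_apply, Finsupp.lapply_apply]
    rw [hli.repr_eq_single j _ rfl, Finsupp.single_apply]
    simp [eq_comm]
  choose g hg using key
  exact ⟨g, hg⟩

theorem mem_closedSpan (x : ℕ → X) (i : ℕ) : x i ∈ closedSpan x :=
  Submodule.le_topologicalClosure _ (Submodule.subset_span ⟨i, rfl⟩)

theorem isClosed_closedSpan (x : ℕ → X) : IsClosed (closedSpan x : Set X) :=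
  Submodule.isClosed_topologicalClosure _

theorem closedSpan_le {x : ℕ → X} {Y : Submodule ℂ X} (hY : IsClosed (Y : Set X))
    (h : ∀ i, x i ∈ Y) : closedSpan x ≤ Y :=
  Submodule.topologicalClosure_minimal _ (Submodule.span_le.2 (Set.range_subset_iff.2 h)) hY

theorem closedSpan_comp_le (x : ℕ → X) (φ : ℕ → ℕ) :
    closedSpan (fun n => x (φ n)) ≤ closedSpan x :=
  closedSpan_le (isClosed_closedSpan x) fun i => mem_closedSpan x (φ i)

/-- Partial sums of the biorthogonal expansion reproduce the span and are uniformly bounded, hence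
converge on the closed span. -/
theorem GrunblumCondition.tendsto_sum {K : ℝ} {x : ℕ → X} (hG : GrunblumCondition K x)
    {g : ℕ → StrongDual ℂ X} (hg : ∀ i j, g i (x j) = if i = j then 1 else 0) {y : X}
    (hy : y ∈ closedSpan x) :
    Tendsto (fun N : ℕ => ∑ n ∈ Finset.range N, g n y • x n) atTop (𝓝 y) := by
  let S : ℕ → X →L[ℂ] X := fun N => ∑ n ∈ Finset.range N, (g n).smulRight (x n)
  have hS : ∀ N y, S N y = ∑ n ∈ Finset.range N, g n y • x n := fun N y => by
    simp [S]
  have hspan : ∀ y ∈ Submodule.span ℂ (Set.range x), ∃ n₀, ∀ n ≥ n₀, S n y = y := by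
    intro y hy
    induction hy using Submodule.span_induction with
    | mem y hy =>
      obtain ⟨j, rfl⟩ := hy
      refine ⟨j + 1, fun n hn => ?_⟩
      rw [hS, Finset.sum_eq_single j]
      · simp [hg]
      · intro b _ hb
        simp [hg, hb]
      · intro h
        exact absurd (Finset.mem_range.2 (by omega)) h
    | zero => exact ⟨0, fun n _ => map_zero _⟩
    | add y z _ _ hy hz =>
      obtain ⟨a, ha⟩ := hy
      obtain ⟨b, hb⟩ := hz
      exact ⟨max a b, fun n hn => by
        rw [map_add, ha n (le_trans (le_max_left _ _) hn), hb n (le_trans (le_max_right _ _) hn)]⟩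
    | smul c y _ hy =>
      obtain ⟨a, ha⟩ := hy
      exact ⟨a, fun n hn => by rw [map_smul, ha n hn]⟩
  have hbound : ∀ m, ∀ y ∈ closedSpan x, ‖S m y‖ ≤ K * ‖y‖ := by
    intro m y hy
    have hcl : IsClosed {y : X | ‖S m y‖ ≤ K * ‖y‖} :=
      isClosed_le (by fun_prop) (by fun_prop)
    refine closure_minimal (fun y hy => ?_) hcl hy
    obtain ⟨n₀, hn₀⟩ := hspan y hy
    have h := hG (fun i => g i y) m (max m n₀) (le_max_left _ _)
    rw [← hS, ← hS, hn₀ _ (le_max_right _ _)] at h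
    exact h
  have hK : 0 ≤ |K| := abs_nonneg K
  rw [Metric.tendsto_atTop]
  intro ε hε
  have hδ : 0 < ε / (|K| + 1) := by positivity
  obtain ⟨z, hz, hyz⟩ := Metric.mem_closure_iff.1 hy _ hδ
  obtain ⟨n₀, hn₀⟩ := hspan z hz
  refine ⟨n₀, fun n hn => ?_⟩
  rw [← hS, dist_eq_norm]
  rw [dist_eq_norm, lt_div_iff₀ (by positivity)] at hyz
  have h1 : S n y - y = S n (y - z) - (y - z) := by
    rw [map_sub, hn₀ n hn]
    abel
  have h2 := hbound n (y - z) (sub_mem hy (Submodule.le_topologicalClosure _ hz))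
  have h3 := norm_sub_le (S n (y - z)) (y - z)
  have h4 := mul_le_mul_of_nonneg_right (le_abs_self K) (norm_nonneg (y - z))
  rw [h1]
  nlinarith

theorem GrunblumCondition.isBasicSequence {K : ℝ} {x : ℕ → X} (hG : GrunblumCondition K x)
    (hx : ∀ i, ‖x i‖ = 1) : IsBasicSequence x := by
  obtain ⟨g, hg⟩ := hG.exists_biorthogonal hx
  intro y hy
  refine ⟨fun n => g n y, hG.tendsto_sum hg hy, fun a ha => funext fun j => ?_⟩
  have h1 := ((g j).continuous.tendsto y).comp ha
  have h2 : Tendsto (fun N : ℕ => g j (∑ n ∈ Finset.range N, a n • x n)) atTop (𝓝 (a j)) := by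
    refine tendsto_const_nhds.congr' ?_
    filter_upwards [eventually_gt_atTop j] with N hN
    rw [map_sum, Finset.sum_eq_single j]
    · simp [hg]
    · intro b _ hb
      simp [hg, hb.symm]
    · intro h
      exact absurd (Finset.mem_range.2 hN) h
  exact tendsto_nhds_unique h2 h1

/-- Padding coefficients with zeros turns partial sums of a subsequence into partial sums of the
whole, so the Grünblum constant is inherited. -/
theorem sum_range_extend (x : ℕ → X) {φ : ℕ → ℕ} (hφ : StrictMono φ) (a : ℕ → ℂ) (m : ℕ) :
    ∑ i ∈ Finset.range (φ m), Function.extend φ a 0 i • x i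
      = ∑ k ∈ Finset.range m, a k • x (φ k) := by
  have h : (Finset.range m).image φ ⊆ Finset.range (φ m) := by
    intro i hi
    obtain ⟨k, hk, rfl⟩ := Finset.mem_image.1 hi
    exact Finset.mem_range.2 (hφ (Finset.mem_range.1 hk))
  rw [← Finset.sum_subset h, Finset.sum_image hφ.injective.injOn]
  · simp [hφ.injective.extend_apply]
  · intro i hi hi'
    rw [Function.extend_apply', Pi.zero_apply, zero_smul]
    rintro ⟨k, rfl⟩
    exact hi' (Finset.mem_image_of_mem φ
      (Finset.mem_range.2 (hφ.lt_iff_lt.1 (Finset.mem_range.1 hi))))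

theorem GrunblumCondition.comp {K : ℝ} {x : ℕ → X} (hG : GrunblumCondition K x) {φ : ℕ → ℕ}
    (hφ : StrictMono φ) : GrunblumCondition K (fun n => x (φ n)) := by
  intro a m n hmn
  rw [← sum_range_extend x hφ, ← sum_range_extend x hφ]
  exact hG _ _ _ (hφ.monotone hmn)

/-- Omitting infinitely many terms of a biorthogonal system leaves a half-space. -/
theorem isHalfSpace_closedSpan {x : ℕ → X} {g : ℕ → StrongDual ℂ X}
    (hg : ∀ i j, g i (x j) = if i = j then 1 else 0) {φ ψ : ℕ → ℕ} (hφ : φ.Injective)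
    (hψ : ψ.Injective) (hφψ : ∀ m n, φ m ≠ ψ n) :
    IsHalfSpace (closedSpan fun n => x (φ n)) := by
  have hli : LinearIndependent ℂ x := by
    rw [linearIndependent_iff]
    intro l hl
    ext j
    have h := congrArg (g j) hl
    rw [Finsupp.linearCombination_apply, Finsupp.sum, map_sum] at h
    simpa [hg] using h
  refine ⟨isClosed_closedSpan _, fun hfin => ?_, fun hfin => ?_⟩
  · have h : LinearIndependent ℂ
        (fun n => (⟨x (φ n), mem_closedSpan (fun n => x (φ n)) n⟩ :
          closedSpan fun n => x (φ n))) := by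
      refine LinearIndependent.of_comp (Submodule.subtype _) ?_
      exact hli.comp φ hφ
    have := h.finite
    exact not_finite ℕ
  -- The functionals of the omitted terms vanish on the closed span and send the omitted vectors to
  -- the standard unit vectors, so these stay independent in the quotient.
  · let G : X →ₗ[ℂ] (ℕ → ℂ) := LinearMap.pi fun k => (g (ψ k)).toLinearMap
    have hle : closedSpan (fun n => x (φ n)) ≤ LinearMap.ker G := by
      intro y hy
      refine LinearMap.mem_ker.2 (funext fun k => ?_)
      have hk : closedSpan (fun n => x (φ n)) ≤ LinearMap.ker (g (ψ k)).toLinearMap :=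
        closedSpan_le (g (ψ k)).isClosed_ker fun i => by
          simp [hg, (hφψ i k).symm]
      exact hk hy
    have h : LinearIndependent ℂ
        (fun k => (closedSpan fun n => x (φ n)).mkQ (x (ψ k))) := by
      refine LinearIndependent.of_comp ((closedSpan fun n => x (φ n)).liftQ G hle) ?_
      have heq : (((closedSpan fun n => x (φ n)).liftQ G hle) ∘
          fun k => (closedSpan fun n => x (φ n)).mkQ (x (ψ k))) =
          fun k => (Pi.single k 1 : ℕ → ℂ) := by
        funext k i
        simp [G, hg, hψ.eq_iff, Pi.single_apply]
      rw [heq]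
      exact Pi.linearIndependent_single_one ℕ ℂ
    have := h.finite
    exact not_finite ℕ

end BasicSequences

/-! ### Mazur's selection of a subsequence in a dual space. -/

section MazurSelection

set_option maxSynthPendingDepth 3

/-- Mazur's argument: a family of functionals bounded below in norm and converging pointwise to
zero is eventually almost orthogonal to a given finite-dimensional space of functionals. -/
theorem eventually_forall_norm_le_mul_norm_add {N ι : Type*} [NormedAddCommGroup N]
    [NormedSpace ℂ N] {U : Filter ι} {z : ι → StrongDual ℂ N}
    (hz : ∀ f, Tendsto (fun i => z i f) U (𝓝 0)) {δ : ℝ} (hδ : 0 < δ) (hzδ : ∀ i, δ ≤ ‖z i‖)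
    (F : Submodule ℂ (StrongDual ℂ N)) [FiniteDimensional ℂ F] {d : ℝ} (hd : 1 < d) :
    ∀ᶠ i in U, ∀ y ∈ F, ∀ a : ℂ, ‖y‖ ≤ d * ‖y + a • z i‖ := by
  have hd0 : 0 < d := by linarith
  have : ProperSpace F := FiniteDimensional.proper ℂ F
  have hsphere : ∀ᶠ i in U, ∀ y ∈ Metric.sphere (0 : F) 1, ∀ a : ℂ,
      1 / d ≤ ‖(y : StrongDual ℂ N) + a • z i‖ := by
    -- By compactness of the sphere, a uniform estimate near each of its points suffices.
    refine (isCompact_sphere (0 : F) 1).induction_on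
      (p := fun s => ∀ᶠ i in U, ∀ y ∈ s, ∀ a : ℂ, 1 / d ≤ ‖(y : StrongDual ℂ N) + a • z i‖)
      (by simp) (fun s t hst ht => ht.mono fun i hi y hy => hi y (hst hy))
      (fun s t hs ht => by
        filter_upwards [hs, ht] with i hi hi' y hy
        exact hy.elim (hi y) (hi' y)) ?_
    intro y₀ hy₀
    obtain ⟨r, hr, hr1⟩ := exists_between ((div_lt_one hd0).2 hd)
    have hy₀1 : ‖(y₀ : StrongDual ℂ N)‖ = 1 := mem_sphere_zero_iff_norm.1 hy₀
    obtain ⟨f, hf, hrf⟩ :=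
      (y₀ : StrongDual ℂ N).exists_lt_apply_of_lt_opNorm (hy₀1.symm ▸ hr1)
    have hopen : ∀ᶠ y : F in 𝓝 y₀, r < ‖(y : StrongDual ℂ N) f‖ := by
      refine ContinuousAt.eventually_lt continuousAt_const ?_ hrf
      have : Continuous fun y : F => (y : StrongDual ℂ N) f :=
        (ContinuousLinearMap.apply ℂ ℂ f).continuous.comp continuous_subtype_val
      exact this.norm.continuousAt
    refine ⟨{y | r < ‖(y : StrongDual ℂ N) f‖} ∩ Metric.sphere 0 1,
      inter_mem (mem_nhdsWithin_of_mem_nhds hopen) self_mem_nhdsWithin, ?_⟩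
    have hη : 0 < (r - 1 / d) * δ / 2 := by
      have := sub_pos.2 hr
      positivity
    have hsmall : ∀ᶠ i in U, ‖z i f‖ < (r - 1 / d) * δ / 2 :=
      (hz f).norm.eventually (gt_mem_nhds (norm_zero.trans_lt hη))
    filter_upwards [hsmall] with i hi
    rintro y ⟨hy, hy1⟩ a
    have hy1 : ‖(y : StrongDual ℂ N)‖ = 1 := mem_sphere_zero_iff_norm.1 hy1
    -- For large `a` the term `a • z i` has norm at least 2 and dominates the unit vector `y`.
    -- Otherwise `‖a‖ ≤ 2 / δ`, and evaluation at `f` changes by at most `r - 1 / d`.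
    rcases le_total 2 (‖a‖ * δ) with ha | ha
    · have h1 : ‖a • z i‖ ≤ ‖(y : StrongDual ℂ N) + a • z i‖ + ‖(y : StrongDual ℂ N)‖ := by
        have := norm_sub_le ((y : StrongDual ℂ N) + a • z i) (y : StrongDual ℂ N)
        rwa [add_sub_cancel_left] at this
      rw [norm_smul, hy1] at h1
      have h2 := mul_le_mul_of_nonneg_left (hzδ i) (norm_nonneg a)
      linarith
    · have h1 : ‖((y : StrongDual ℂ N) + a • z i) f‖ ≤ ‖(y : StrongDual ℂ N) + a • z i‖ :=
        ((y : StrongDual ℂ N) + a • z i).le_of_opNorm_le_of_le le_rfl hf.le |>.trans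
          (mul_one _).le
      have h2 : ‖(y : StrongDual ℂ N) f‖ ≤
          ‖((y : StrongDual ℂ N) + a • z i) f‖ + ‖a‖ * ‖z i f‖ := by
        have := norm_sub_le (((y : StrongDual ℂ N) + a • z i) f) (a • z i f)
        simpa [norm_smul] using this
      have h3 : ‖a‖ * ‖z i f‖ ≤ r - 1 / d := by
        have h4 := mul_le_mul_of_nonneg_left hi.le (norm_nonneg a)
        have h5 := mul_le_mul_of_nonneg_right ha (sub_pos.2 hr).le
        nlinarith
      have hy : r < ‖(y : StrongDual ℂ N) f‖ := hy
      linarith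
  filter_upwards [hsphere] with i hi y hy a
  rcases eq_or_ne y 0 with rfl | hy0
  · simpa using mul_nonneg hd0.le (norm_nonneg (a • z i))
  have hn : 0 < ‖y‖ := norm_pos_iff.2 hy0
  have hmem : ((‖y‖⁻¹ : ℝ) : ℂ) • (⟨y, hy⟩ : F) ∈ Metric.sphere (0 : F) 1 := by
    rw [mem_sphere_zero_iff_norm, norm_smul, Complex.norm_real, norm_inv, norm_norm]
    exact inv_mul_cancel₀ hn.ne'
  have h := hi _ hmem (((‖y‖⁻¹ : ℝ) : ℂ) * a)
  have h' : ((((‖y‖⁻¹ : ℝ) : ℂ) • (⟨y, hy⟩ : F) : F) : StrongDual ℂ N)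
      + (((‖y‖⁻¹ : ℝ) : ℂ) * a) • z i = ((‖y‖⁻¹ : ℝ) : ℂ) • (y + a • z i) := by
    simp [smul_add, mul_smul]
  rw [h', norm_smul, Complex.norm_real, norm_inv, norm_norm, div_le_iff₀ hd0] at h
  calc ‖y‖ = ‖y‖ * 1 := (mul_one _).symm
    _ ≤ ‖y‖ * (‖y‖⁻¹ * ‖y + a • z i‖ * d) := by gcongr
    _ = d * ‖y + a • z i‖ := by field_simp

/-- A sequence of functionals bounded below in norm and converging pointwise to zero along a free
filter has a subsequence satisfying the Grünblum condition. -/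
theorem exists_strictMono_grunblumCondition {N : Type*} [NormedAddCommGroup N]
    [NormedSpace ℂ N] {U : Filter ℕ} [U.NeBot] (hU : U ≤ atTop) {z : ℕ → StrongDual ℂ N}
    (hz : ∀ f, Tendsto (fun i => z i f) U (𝓝 0)) {δ : ℝ} (hδ : 0 < δ) (hzδ : ∀ i, δ ≤ ‖z i‖) :
    ∃ φ : ℕ → ℕ, StrictMono φ ∧ GrunblumCondition 2 (fun n => z (φ n)) := by
  -- Weights increasing within `[1, 2]`: the ratios `w (n + 1) / w n > 1` are the allowed losses in
  -- Mazur's step, and their products telescope to at most 2.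
  let w : ℕ → ℝ := fun n => 2 - (1 / 2) ^ n
  have hw : StrictMono w := by
    refine strictMono_nat_of_lt_succ fun n => ?_
    have : (0 : ℝ) < (1 / 2) ^ n := by positivity
    simp only [w, pow_succ]
    linarith
  have hw1 : ∀ n, 1 ≤ w n := fun n => by
    have := hw.monotone (Nat.zero_le n)
    simp only [w, pow_zero] at this ⊢
    linarith
  have hw2 : ∀ n, w n ≤ 2 := fun n => by
    have : (0 : ℝ) < (1 / 2) ^ n := by positivity
    simp only [w]
    linarith
  have hnext : ∀ n, ∃ k, n < k ∧ ∀ y ∈ Submodule.span ℂ (z '' Set.Iic n), ∀ a : ℂ,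
      w n * ‖y‖ ≤ w (n + 1) * ‖y + a • z k‖ := by
    intro n
    have hwn : 0 < w n := by linarith [hw1 n]
    have : FiniteDimensional ℂ (Submodule.span ℂ (z '' Set.Iic n)) :=
      FiniteDimensional.span_of_finite ℂ ((Set.finite_Iic n).image z)
    obtain ⟨k, hk, hnk⟩ := ((eventually_forall_norm_le_mul_norm_add hz hδ hzδ
      (Submodule.span ℂ (z '' Set.Iic n))
      ((one_lt_div hwn).2 (hw n.lt_succ_self))).and (hU (eventually_gt_atTop n))).exists
    refine ⟨k, hnk, fun y hy a => ?_⟩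
    have := hk y hy a
    rwa [div_mul_eq_mul_div, le_div_iff₀ hwn, mul_comm] at this
  choose s hs hsy using hnext
  let φ : ℕ → ℕ := fun n => s^[n] 0
  have hφs : ∀ n, φ (n + 1) = s (φ n) := fun n => Function.iterate_succ_apply' s n 0
  have hφ : StrictMono φ := strictMono_nat_of_lt_succ fun n => by
    rw [hφs]
    exact hs _
  refine ⟨φ, hφ, fun a m n hmn => ?_⟩
  have hmono : Monotone fun m => w (φ m) * ‖∑ i ∈ Finset.range (m + 1), a i • z (φ i)‖ := by
    refine monotone_nat_of_le_succ fun m => ?_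
    rw [Finset.sum_range_succ _ (m + 1), hφs]
    refine (hsy (φ m) _ ?_ (a (m + 1))).trans ?_
    · refine Submodule.sum_mem _ fun i hi => Submodule.smul_mem _ _ (Submodule.subset_span ?_)
      exact ⟨φ i, hφ.monotone (Nat.lt_succ_iff.1 (Finset.mem_range.1 hi)), rfl⟩
    · exact mul_le_mul_of_nonneg_right (hw.monotone (hs _)) (norm_nonneg _)
  rcases m with _ | m
  · simp
  obtain ⟨n, rfl⟩ : ∃ k, n = k + 1 := ⟨n - 1, by omega⟩
  have h := hmono (Nat.le_of_succ_le_succ hmn)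
  calc ‖∑ i ∈ Finset.range (m + 1), a i • z (φ i)‖
      ≤ w (φ m) * ‖∑ i ∈ Finset.range (m + 1), a i • z (φ i)‖ :=
        le_mul_of_one_le_left (norm_nonneg _) (hw1 _)
    _ ≤ _ := h
    _ ≤ _ := mul_le_mul_of_nonneg_right (hw2 _) (norm_nonneg _)

end MazurSelection

/-! ### From weak clustering to a subsequence with the Grünblum condition. -/

section BasicSubsequences

set_option maxSynthPendingDepth 3

variable {X : Type*} [NormedAddCommGroup X] [NormedSpace ℂ X]

/-- The restriction of the canonical image of a vector in the bidual to a subspace of the dual. -/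
noncomputable def evalOn (N : Submodule ℂ (StrongDual ℂ X)) : X →L[ℂ] StrongDual ℂ N :=
  ((ContinuousLinearMap.compL ℂ N (StrongDual ℂ X) ℂ).flip N.subtypeL).comp
    (NormedSpace.inclusionInDoubleDual ℂ X)

@[simp]
theorem evalOn_apply (N : Submodule ℂ (StrongDual ℂ X)) (x : X) (f : N) :
    evalOn N x f = (f : StrongDual ℂ X) x := rfl

theorem norm_evalOn_le (N : Submodule ℂ (StrongDual ℂ X)) (x : X) : ‖evalOn N x‖ ≤ ‖x‖ := by
  refine ContinuousLinearMap.opNorm_le_bound _ (norm_nonneg _) fun f => ?_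
  rw [evalOn_apply, mul_comm]
  exact (f : StrongDual ℂ X).le_opNorm x

/-- The kernel of an element of the bidual that is zero or does not come from the space itself is
a norming subspace of the dual. -/
theorem exists_norm_le_mul_norm_evalOn_ker [CompleteSpace X]
    (Φ : StrongDual ℂ (StrongDual ℂ X))
    (hΦ : ∀ x, NormedSpace.inclusionInDoubleDual ℂ X x = Φ → x = 0) :
    ∃ C > 0, ∀ y, ‖y‖ ≤ C * ‖evalOn (LinearMap.ker Φ.toLinearMap) y‖ := by
  let J := NormedSpace.inclusionInDoubleDualLi ℂ (E := X)
  have hclosed : IsClosed (Set.range J) := J.isometry.isClosedEmbedding.isClosed_range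
  -- If `Φ` is outside the closed image of `X`, it has positive distance from it, which bounds the
  -- `Φ`-component of `J y - c • Φ`.
  obtain ⟨d, hd, hdΦ⟩ : ∃ d > 0, ∀ (c : ℂ) (y : X), ‖c‖ * ‖Φ‖ ≤ d * ‖J y - c • Φ‖ := by
    by_cases h : Φ ∈ Set.range J
    · obtain ⟨x, hx⟩ := h
      have hx0 : x = 0 := hΦ x hx
      have : Φ = 0 := by rw [← hx, hx0, map_zero]
      exact ⟨1, one_pos, fun c y => by simp [this]⟩
    · obtain ⟨r, hr, hball⟩ := Metric.isOpen_iff.1 hclosed.isOpen_compl Φ h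
      refine ⟨‖Φ‖ / r + 1, by positivity, fun c y => ?_⟩
      rcases eq_or_ne c 0 with rfl | hc
      · simp only [norm_zero, zero_mul]
        positivity
      have h1 : r ≤ ‖J (c⁻¹ • y) - Φ‖ := by
        by_contra! hlt
        exact hball (by rwa [Metric.mem_ball, dist_eq_norm]) ⟨_, rfl⟩
      have h2 : J y - c • Φ = c • (J (c⁻¹ • y) - Φ) := by
        rw [map_smul, smul_sub, smul_inv_smul₀ hc]
      rw [h2, norm_smul]
      calc ‖c‖ * ‖Φ‖ = ‖Φ‖ / r * (‖c‖ * r) := by field_simp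
        _ ≤ ‖Φ‖ / r * (‖c‖ * ‖J (c⁻¹ • y) - Φ‖) := by gcongr
        _ ≤ _ := by
          rw [add_mul, one_mul]
          exact le_add_of_nonneg_right (by positivity)
  refine ⟨1 + d, by positivity, fun y => ?_⟩
  obtain ⟨G, hG, hGn⟩ := exists_extension_norm_eq (LinearMap.ker Φ.toLinearMap)
    (evalOn (LinearMap.ker Φ.toLinearMap) y)
  -- `J y` and its norm-preserving modification `G` agree on `ker Φ`, so they differ by a multiple
  -- of `Φ`.
  obtain ⟨c, hc⟩ : ∃ c : ℂ, J y - G = c • Φ := by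
    have hker : LinearMap.ker Φ.toLinearMap ≤ LinearMap.ker (J y - G).toLinearMap := by
      intro f hf
      have := hG ⟨f, hf⟩
      rw [evalOn_apply] at this
      simp only [LinearMap.mem_ker, ContinuousLinearMap.coe_coe, sub_apply]
      rw [this]
      exact sub_self _
    have hmem := mem_span_of_iInf_ker_le_ker (L := fun _ : Unit => Φ.toLinearMap)
      (by simpa using hker)
    rw [Set.range_const, Submodule.mem_span_singleton] at hmem
    obtain ⟨c, hc⟩ := hmem
    exact ⟨c, ContinuousLinearMap.coe_injective hc.symm⟩
  have h1 : J y - c • Φ = G := by rw [← hc]; abel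
  have h2 := hdΦ c y
  have h3 : ‖y‖ ≤ ‖G‖ + ‖c‖ * ‖Φ‖ := by
    rw [← J.norm_map y, ← norm_smul, ← hc]
    have := norm_add_le G (J y - G)
    rwa [add_sub_cancel] at this
  rw [h1] at h2
  rw [← hGn]
  linarith

/-- A normalized sequence that cannot accumulate weakly at a nonzero vector has a subsequence
satisfying the Grünblum condition. -/
theorem exists_strictMono_grunblumCondition_of_cluster [CompleteSpace X] {x : ℕ → X}
    (hx : ∀ n, ‖x n‖ = 1)
    (hw : ∀ y : X, (∀ f : StrongDual ℂ X,
      Tendsto (fun n => f (x n)) (hyperfilter ℕ) (𝓝 (f y))) → y = 0) :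
    ∃ (φ : ℕ → ℕ) (K : ℝ), StrictMono φ ∧ GrunblumCondition K (fun n => x (φ n)) := by
  obtain ⟨Φ, hΦ⟩ : ∃ Φ : StrongDual ℂ (StrongDual ℂ X),
      ∀ f, Tendsto (fun n => f (x n)) (hyperfilter ℕ) (𝓝 (Φ f)) := by
    -- Banach–Alaoglu: the image ultrafilter lives on a weak-star compact ball and so converges.
    let u : ℕ → WeakDual ℂ (StrongDual ℂ X) := fun n =>
      StrongDual.toWeakDual (NormedSpace.inclusionInDoubleDual ℂ X (x n))
    obtain ⟨Φ, -, hΦ⟩ := (WeakDual.isCompact_closedBall (𝕜 := ℂ)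
      (0 : StrongDual ℂ (StrongDual ℂ X)) 1).ultrafilter_le_nhds ((hyperfilter ℕ).map u) (by
        rw [le_principal_iff]
        refine mem_map.2 (Filter.univ_mem' fun n => ?_)
        have h : ‖NormedSpace.inclusionInDoubleDual ℂ X (x n)‖ ≤ 1 :=
          (hx n) ▸ ((NormedSpace.inclusionInDoubleDualLi ℂ (E := X)).norm_map (x n)).le
        simpa [u] using h)
    refine ⟨WeakDual.toStrongDual Φ, fun f => ?_⟩
    exact ((WeakDual.eval_continuous f).tendsto Φ).comp hΦ
  obtain ⟨C, hC, hCy⟩ := exists_norm_le_mul_norm_evalOn_ker Φ fun y hy =>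
    hw y fun f => by
      have := hΦ f
      rwa [← hy] at this
  set N := LinearMap.ker Φ.toLinearMap
  obtain ⟨φ, hφ, hG⟩ := exists_strictMono_grunblumCondition (N := N)
    (Nat.hyperfilter_le_atTop) (z := fun n => evalOn N (x n))
    (fun f => by
      have := hΦ f
      rwa [show Φ f = 0 from f.2] at this) (inv_pos.2 hC) (fun n => by
      rw [inv_le_iff_one_le_mul₀' hC, ← hx n]
      exact hCy (x n))
  -- `C` is the cost of returning from the dual of `N` to `X`; 2 is the constant of the selection.
  refine ⟨φ, C * 2, hφ, fun a m n hmn => ?_⟩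
  have h := hG a m n hmn
  simp only [← map_smul, ← map_sum] at h
  calc _ ≤ C * ‖evalOn N (∑ i ∈ Finset.range m, a i • x (φ i))‖ := hCy _
    _ ≤ C * (2 * ‖evalOn N (∑ i ∈ Finset.range n, a i • x (φ i))‖) := by gcongr
    _ ≤ C * (2 * ‖∑ i ∈ Finset.range n, a i • x (φ i)‖) := by
      gcongr
      exact norm_evalOn_le _ _
    _ = _ := by ring

end BasicSubsequences

/-! ### Resolvent vectors near a boundary point of the spectrum. -/

section ResolventVectors

variable {X : Type*} [NormedAddCommGroup X] [NormedSpace ℂ X]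

theorem apply_resolventVec (T : X →L[ℂ] X) {l : ℂ} (hl : l ∈ resolventSet ℂ T) (e : X) :
    T (resolventVec T l e) = l • resolventVec T l e - e := by
  have h : (algebraMap ℂ (X →L[ℂ] X) l - T) * resolvent T l = 1 :=
    Ring.mul_inverse_cancel _ hl
  have h' := congrArg (fun S : X →L[ℂ] X => S e) h
  simp only [mul_apply_eq_comp, sub_apply,
    one_apply_eq_self, Algebra.algebraMap_eq_smul_one,
    smul_apply] at h'
  rw [resolventVec, eq_sub_iff_add_eq, add_comm]
  exact (sub_eq_iff_eq_add.1 h').symm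

theorem apply_normalizedResolventVec (T : X →L[ℂ] X) {l : ℂ} (hl : l ∈ resolventSet ℂ T)
    (e : X) : T (normalizedResolventVec T l e) =
      l • normalizedResolventVec T l e - ((‖resolventVec T l e‖⁻¹ : ℝ) : ℂ) • e := by
  rw [normalizedResolventVec, map_smul, apply_resolventVec T hl, smul_sub, smul_comm]

theorem resolventVec_ne_zero (T : X →L[ℂ] X) {l : ℂ} (hl : l ∈ resolventSet ℂ T) {e : X}
    (he : e ≠ 0) : resolventVec T l e ≠ 0 := by
  intro h
  have := apply_resolventVec T hl e
  rw [h, map_zero, smul_zero, zero_sub, eq_comm, neg_eq_zero] at this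
  exact he this

theorem norm_normalizedResolventVec (T : X →L[ℂ] X) {l : ℂ} (hl : l ∈ resolventSet ℂ T) {e : X}
    (he : e ≠ 0) : ‖normalizedResolventVec T l e‖ = 1 := by
  rw [normalizedResolventVec, norm_smul, Complex.norm_real, norm_inv, norm_norm,
    inv_mul_cancel₀ (norm_ne_zero_iff.2 (resolventVec_ne_zero T hl he))]

/-- The resolvent is at least as large as the inverse distance to the spectrum. -/
theorem one_le_norm_sub_mul_norm_resolvent [CompleteSpace X] [Nontrivial X] (T : X →L[ℂ] X)
    {l μ : ℂ} (hl : l ∈ resolventSet ℂ T) (hμ : μ ∈ spectrum ℂ T) :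
    1 ≤ ‖l - μ‖ * ‖resolvent T l‖ := by
  obtain ⟨u, hu⟩ : IsUnit (algebraMap ℂ (X →L[ℂ] X) l - T) := hl
  have hinv : ((u⁻¹ : (X →L[ℂ] X)ˣ) : X →L[ℂ] X) = resolvent T l := by
    rw [resolvent, ← hu, Ring.inverse_unit]
  have hpos : 0 < ‖resolvent T l‖ := by
    rw [← hinv]
    exact Units.norm_pos u⁻¹
  by_contra! h
  -- Otherwise `μ - T` is closer to `l - T` than the inverse norm of the resolvent, hence
  -- invertible.
  refine hμ (Units.isUnit (u.ofNearby (algebraMap ℂ (X →L[ℂ] X) μ - T) ?_))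
  rw [hu, hinv, sub_sub_sub_cancel_right, ← map_sub, norm_algebraMap', norm_sub_rev]
  rwa [← one_div, lt_div_iff₀ hpos]

/-- Near a boundary point of the spectrum some unit vector has unbounded resolvent orbit. -/
theorem exists_tendsto_norm_resolventVec [CompleteSpace X] (T : X →L[ℂ] X) {μ : ℂ}
    (hμ : μ ∈ frontier (spectrum ℂ T)) :
    ∃ (e : X) (l : ℕ → ℂ), ‖e‖ = 1 ∧ (∀ n, l n ∈ resolventSet ℂ T) ∧ Tendsto l atTop (𝓝 μ) ∧
      Tendsto (fun n => ‖resolventVec T (l n) e‖) atTop atTop := by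
  have hμσ : μ ∈ spectrum ℂ T := (spectrum.isClosed T).frontier_subset hμ
  have : Nontrivial X := by
    by_contra h
    rw [not_nontrivial_iff_subsingleton] at h
    exact hμσ (isUnit_of_subsingleton _)
  have hμρ : μ ∈ closure (resolventSet ℂ T) := by
    rw [frontier_eq_closure_inter_closure] at hμ
    simpa [spectrum] using hμ.2
  obtain ⟨l, hl, hlμ⟩ := mem_closure_iff_seq_limit.1 hμρ
  obtain ⟨e, he⟩ : ∃ e, ∀ C, ∃ n, C < ‖resolvent T (l n) e‖ := by
    by_contra! h
    obtain ⟨C, hC⟩ := banach_steinhaus (g := fun n => resolvent T (l n)) h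
    have hC0 : 0 ≤ C := (norm_nonneg _).trans (hC 0)
    have h0 : Tendsto (fun n => ‖l n - μ‖ * C) atTop (𝓝 0) := by
      simpa using (tendsto_iff_norm_sub_tendsto_zero.1 hlμ).mul_const C
    obtain ⟨n, hn⟩ := (h0.eventually (gt_mem_nhds one_pos)).exists
    have h1 := one_le_norm_sub_mul_norm_resolvent T (hl n) hμσ
    have h2 := mul_le_mul_of_nonneg_left (hC n) (norm_nonneg (l n - μ))
    linarith
  have he0 : e ≠ 0 := by
    rintro rfl
    obtain ⟨n, hn⟩ := he 0
    simp at hn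
  -- The orbit is so far only unbounded; a subsequence tending to infinity exists once `atTop` is a
  -- cluster point of the norms. Exceeding the sum of the first `n₀` norms forces `n ≥ n₀`.
  have hne : (atTop ⊓ map (fun n => ‖resolvent T (l n) e‖) atTop : Filter ℝ).NeBot := by
    refine inf_neBot_iff.2 fun s hs t ht => ?_
    obtain ⟨C, hC⟩ := mem_atTop_sets.1 hs
    obtain ⟨n₀, hn₀⟩ := mem_atTop_sets.1 (mem_map.1 ht)
    obtain ⟨n, hn⟩ := he (max C (∑ i ∈ Finset.range n₀, ‖resolvent T (l i) e‖))
    refine ⟨_, hC _ ((le_max_left _ _).trans hn.le), hn₀ n ?_⟩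
    by_contra! hlt
    exact ((le_max_right _ _).trans_lt hn).not_ge (Finset.single_le_sum
      (f := fun i => ‖resolvent T (l i) e‖) (fun i _ => norm_nonneg _) (Finset.mem_range.2 hlt))
  obtain ⟨θ, hθ, hθt⟩ := Filter.subseq_tendsto_of_neBot hne
  refine ⟨((‖e‖⁻¹ : ℝ) : ℂ) • e, l ∘ θ, ?_, fun n => hl _, hlμ.comp hθ.tendsto_atTop, ?_⟩
  · rw [norm_smul, Complex.norm_real, norm_inv, norm_norm,
      inv_mul_cancel₀ (norm_ne_zero_iff.2 he0)]
  · have h := hθt.const_mul_atTop (inv_pos.2 (norm_pos_iff.2 he0))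
    refine h.congr fun n => ?_
    simp [resolventVec, norm_smul]

theorem exists_grunblumCondition_normalizedResolventVec [CompleteSpace X] (T : X →L[ℂ] X)
    {μ : ℂ} (hμ_eig : ¬ Module.End.HasEigenvalue (T : X →ₗ[ℂ] X) μ) {e : X} {l : ℕ → ℂ}
    (he : e ≠ 0) (hl : ∀ n, l n ∈ resolventSet ℂ T) (hlμ : Tendsto l atTop (𝓝 μ))
    (hle : Tendsto (fun n => ‖resolventVec T (l n) e‖) atTop atTop) :
    ∃ (φ : ℕ → ℕ) (K : ℝ), StrictMono φ ∧
      GrunblumCondition K (fun n => normalizedResolventVec T (l (φ n)) e) := by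
  refine exists_strictMono_grunblumCondition_of_cluster
    (x := fun n => normalizedResolventVec T (l n) e)
    (fun n => norm_normalizedResolventVec T (hl n) he) fun y hy => ?_
  -- Test against each `f` and pass to the limit in the identity for `T x_n`; the `e`-term dies
  -- because its coefficient tends to zero.
  have hTy : T y = μ • y := by
    refine SeparatingDual.eq_iff_forall_dual_eq (R := ℂ) |>.2 fun f => ?_
    have h1 := hy (f.comp T)
    have h2 : Tendsto (fun n => l n * f (normalizedResolventVec T (l n) e)
        - ((‖resolventVec T (l n) e‖⁻¹ : ℝ) : ℂ) * f e) (hyperfilter ℕ) (𝓝 (μ * f y)) := by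
      have h3 : Tendsto (fun n => ((‖resolventVec T (l n) e‖⁻¹ : ℝ) : ℂ)) (hyperfilter ℕ)
          (𝓝 0) := by
        rw [← Complex.ofReal_zero]
        exact (Complex.continuous_ofReal.tendsto 0).comp
          (hle.inv_tendsto_atTop.mono_left Nat.hyperfilter_le_atTop)
      simpa using ((hlμ.mono_left Nat.hyperfilter_le_atTop).mul (hy f)).sub (h3.mul_const (f e))
    have h4 : ∀ n, (f.comp T) (normalizedResolventVec T (l n) e) =
        l n * f (normalizedResolventVec T (l n) e)
          - ((‖resolventVec T (l n) e‖⁻¹ : ℝ) : ℂ) * f e := fun n => by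
      rw [ContinuousLinearMap.comp_apply, apply_normalizedResolventVec T (hl n), map_sub,
        map_smul, map_smul, smul_eq_mul, smul_eq_mul]
    simp only [h4] at h1
    rw [map_smul, smul_eq_mul]
    exact tendsto_nhds_unique h1 h2
  by_contra hy0
  exact hμ_eig (Module.End.hasEigenvalue_of_hasEigenvector
    (Module.End.hasEigenvector_iff.2 ⟨Module.End.mem_eigenspace_iff.2 hTy, hy0⟩))

/-- Clear on generators; it passes to the closure because a closed subspace plus a
finite-dimensional one is closed. -/
theorem apply_mem_closedSpan_sup_span (T : X →L[ℂ] X) {e : X} {l : ℕ → ℂ}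
    (hl : ∀ n, l n ∈ resolventSet ℂ T) {y : X}
    (hy : y ∈ closedSpan fun n => normalizedResolventVec T (l n) e) :
    T y ∈ closedSpan (fun n => normalizedResolventVec T (l n) e) ⊔ Submodule.span ℂ {e} := by
  have hcl := Submodule.isClosed_sup_finiteDimensional
    (closedSpan fun n => normalizedResolventVec T (l n) e) (Submodule.span ℂ {e})
    (isClosed_closedSpan _)
  have hle : closedSpan (fun n => normalizedResolventVec T (l n) e) ≤
      (closedSpan (fun n => normalizedResolventVec T (l n) e) ⊔
        Submodule.span ℂ {e}).comap (T : X →ₗ[ℂ] X) := by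
    refine closedSpan_le (hcl.preimage T.continuous) fun n => ?_
    rw [Submodule.mem_comap, ContinuousLinearMap.coe_coe, apply_normalizedResolventVec T (hl n)]
    refine sub_mem (Submodule.mem_sup_left (Submodule.smul_mem _ _ (mem_closedSpan _ n)))
      (Submodule.mem_sup_right (Submodule.smul_mem _ _ (Submodule.mem_span_singleton_self e)))
  exact hle hy

/-- Defect zero would make the span invariant, and then the identity for `T x_0`, where `e` has a
nonzero coefficient, would put `e` in it. -/
theorem hasDefect_one_closedSpan (T : X →L[ℂ] X) {e : X} {l : ℕ → ℂ} (he : e ≠ 0)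
    (hl : ∀ n, l n ∈ resolventSet ℂ T)
    (heY : e ∉ closedSpan fun n => normalizedResolventVec T (l n) e) :
    HasDefect T (closedSpan fun n => normalizedResolventVec T (l n) e) 1 := by
  refine ⟨⟨Submodule.span ℂ {e}, inferInstance, finrank_span_singleton he,
    fun y hy => apply_mem_closedSpan_sup_span T hl hy⟩, ?_⟩
  rintro k ⟨M, hM, rfl, hTM⟩
  by_contra! hlt
  have hM0 : M = ⊥ := Submodule.finrank_eq_zero.1 (Nat.lt_one_iff.1 hlt)
  have h := hTM _ (mem_closedSpan (fun n => normalizedResolventVec T (l n) e) 0)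
  rw [hM0, sup_bot_eq, apply_normalizedResolventVec T (hl 0)] at h
  have h' := sub_mem (Submodule.smul_mem _ (l 0)
    (mem_closedSpan (fun n => normalizedResolventVec T (l n) e) 0)) h
  rw [sub_sub_cancel, Submodule.smul_mem_iff _ (by
    simpa using resolventVec_ne_zero T (hl 0) he)] at h'
  exact heY h'

end ResolventVectors

/-! ### Choice of the half and the theorem. -/

/-- A nonzero vector lies outside the closed span of one of two complementary halves of a
sequence satisfying the Grünblum condition. -/
theorem GrunblumCondition.notMem_closedSpan_or {X : Type*} [NormedAddCommGroup X]
    [NormedSpace ℂ X] {K : ℝ} {x : ℕ → X} (hG : GrunblumCondition K x)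
    {g : ℕ → StrongDual ℂ X} (hg : ∀ i j, g i (x j) = if i = j then 1 else 0)
    {φ ψ : ℕ → ℕ} (hφψ : ∀ m n, φ m ≠ ψ n) {e : X} (he : e ≠ 0) :
    e ∉ closedSpan (fun n => x (φ n)) ∨ e ∉ closedSpan (fun n => x (ψ n)) := by
  by_contra! h
  have hzero : ∀ (χ : ℕ → ℕ) (i : ℕ), (∀ n, χ n ≠ i) → e ∈ closedSpan (fun n => x (χ n)) →
      g i e = 0 := fun χ i hi hmem => by
    have hle : closedSpan (fun n => x (χ n)) ≤ LinearMap.ker (g i).toLinearMap :=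
      closedSpan_le (g i).isClosed_ker fun n => by simp [hg, (hi n).symm]
    exact hle hmem
  -- Every index is missed by `φ` or by `ψ`, so all coordinates of `e` vanish and its expansion
  -- gives `e = 0`.
  have hge : ∀ i, g i e = 0 := fun i => by
    by_cases hi : ∃ m, φ m = i
    · obtain ⟨m, rfl⟩ := hi
      exact hzero ψ _ (fun n => (hφψ m n).symm) h.2
    · exact hzero φ i (not_exists.1 hi) h.1
  have := hG.tendsto_sum hg (closedSpan_comp_le x φ h.1)
  simp only [hge, zero_smul, Finset.sum_const_zero] at this
  exact he (tendsto_nhds_unique this tendsto_const_nhds)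

theorem theorem2p2 {X : Type*} [NormedAddCommGroup X] [NormedSpace ℂ X] [CompleteSpace X]
    (T : X →L[ℂ] X) (μ : ℂ) (hμ : μ ∈ frontier (spectrum ℂ T))
    (hμ_eig : ¬ Module.End.HasEigenvalue (T : X →ₗ[ℂ] X) μ) :
    ∃ Y : Submodule ℂ X,
      IsHalfSpace Y ∧ IsAlmostInvariant T Y ∧ HasDefect T Y 1 ∧
      ∃ (e : X) (l : ℕ → ℂ) (φ : ℕ → ℕ),
        ‖e‖ = 1 ∧
        (∀ n, l n ∈ resolventSet ℂ T) ∧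
        Tendsto l atTop (𝓝 μ) ∧
        Tendsto (fun n => ‖resolventVec T (l n) e‖) atTop atTop ∧
        StrictMono φ ∧
        IsBasicSequence (fun n => normalizedResolventVec T (l (φ n)) e) ∧
        Y = closedSpan (fun n => normalizedResolventVec T (l (φ n)) e) := by
  obtain ⟨e, l, he1, hl, hlμ, hle⟩ := exists_tendsto_norm_resolventVec T hμ
  have he : e ≠ 0 := by
    rintro rfl
    simp at he1
  obtain ⟨φ, K, hφ, hG⟩ :=
    exists_grunblumCondition_normalizedResolventVec T hμ_eig he hl hlμ hle
  have hx : ∀ n, ‖normalizedResolventVec T (l (φ n)) e‖ = 1 := fun n =>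
    norm_normalizedResolventVec T (hl _) he
  obtain ⟨g, hg⟩ := hG.exists_biorthogonal hx
  -- One halving serves two ends: the discarded terms `ω` give infinite codimension, and the kept
  -- half avoids `e`.
  obtain ⟨χ, ω, hχ, hω, hχω, heχ⟩ : ∃ χ ω : ℕ → ℕ, StrictMono χ ∧ StrictMono ω ∧
      (∀ m n, χ m ≠ ω n) ∧
      e ∉ closedSpan (fun n => normalizedResolventVec T (l (φ (χ n))) e) := by
    have heven : StrictMono fun n : ℕ => 2 * n := fun a b h => by simpa using h
    have hodd : StrictMono fun n : ℕ => 2 * n + 1 := fun a b h => by simpa using h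
    rcases hG.notMem_closedSpan_or hg (φ := fun n => 2 * n) (ψ := fun n => 2 * n + 1)
      (fun m n => by omega) he with h | h
    · exact ⟨_, _, heven, hodd, fun m n => by omega, h⟩
    · exact ⟨_, _, hodd, heven, fun m n => by omega, h⟩
  refine ⟨closedSpan fun n => normalizedResolventVec T (l (φ (χ n))) e,
    isHalfSpace_closedSpan hg hχ.injective hω.injective hχω,
    ⟨isClosed_closedSpan _, Submodule.span ℂ {e}, inferInstance, fun y hy =>
      apply_mem_closedSpan_sup_span T (fun n => hl (φ (χ n))) hy⟩,
    hasDefect_one_closedSpan T he (fun n => hl (φ (χ n))) heχ,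
    e, l, φ ∘ χ, he1, hl, hlμ, hle, hφ.comp hχ,
    (hG.comp hχ).isBasicSequence fun n => hx _, rfl⟩
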